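/- Let $L_{\mathrm{prof}}$ be the 2-sorted first-order language with a group sort carrying the language of groups, an index sort carrying a binary relation $\le$, and a relation $K$ between the group sort and the index sort. Let $\mathcal G=(G,I)$ be a *full 2-sorted profinite group*, that is, an $L_{\mathrm{prof}}$-structure in which $G$ is a profinite group, $(I,\le)$ is a partially ordered set, $K_i:=\{x\in G: K(x,i)\}$ is an open subgroup of $G$ for each $i\in I$, the family $\{K_i: i\in I\}$ is a basis of neighbourhoods of $1$ in $G$, for all $i,j\in I$ we have $i\le j$ if and only if $K_i\supseteq K_j$, and every open subgroup of $G$ is equal to $K_i$ for some $i\in I$. Suppose that the complete theory $T=\mathrm{Th}(\mathcal G)$ is NTP$_2$, that is, there do not exist a formula $\phi(\bar x,\bar y)$ of $L_{\mathrm{prof}}$, a number $k\in\mathbb N$, a model $M$ of $T$ and tuples $\bar a_{ij}$ $(i,j\in\mathbb N)$ from $M$ of the sorts of $\bar y$, such that (i) for each $i\in\mathbb N$ and any $k$ distinct $j_1,\dots,j_k\in\mathbb N$, the conjunction $\bigwedge_{t=1}^{k}\phi(\bar x,\bar a_{i j_t})$ has no solution in $M$; and (ii) for every function $f:\mathbb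 N\to\mathbb N$, the set of formulas $\{\phi(\bar x,\bar a_{i,f(i)}): i\in\mathbb N\}$ is consistent, i.e. each of its finite subsets has a solution in $M$. Then $G$ has finite rank as a profinite group: there is $r\in\mathbb N$ such that every closed subgroup $H$ of $G$ has a subset of at most $r$ elements which generates a dense subgroup of $H$ (and the rank of $G$ is the least such $r$). -/

import Mathlib

universe u v

open Topology

/-! ## The two-sorted first-order language of profinite groups

Sorts: a group sort and an index sort. Symbols: multiplication, inverse and identity on the group
sort, a binary relation `≤` on the index sort, and a relation `K` between the two sorts. -/

/-- A (two-sorted) structure for the language: carriers for the two sorts, and interpretations of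
the symbols. No axioms are imposed. -/
structure ProfStructure : Type (max (u + 1) (v + 1)) where
  /-- the group sort -/
  Gp : Type u
  /-- the index sort -/
  Ix : Type v
  one : Gp
  mul : Gp → Gp → Gp
  inv : Gp → Gp
  le : Ix → Ix → Prop
  K : Gp → Ix → Prop

/-- Terms of the group sort in `m` variables of the group sort. (The only terms of the index sort
are variables.) -/
inductive ProfTerm (m : ℕ) : Type
  | var (i : Fin m) : ProfTerm m
  | one : ProfTerm m
  | mul (s t : ProfTerm m) : ProfTerm m
  | inv (t : ProfTerm m) : ProfTerm m

/-- First-order formulas with free variables among `m` variables of the group sort and `n` variables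
of the index sort. A quantifier binds the last variable of its sort. The other connectives and the
existential quantifiers are definable from these ones as usual. -/
inductive ProfFormula : ℕ → ℕ → Type
  | falsum {m n : ℕ} : ProfFormula m n
  | eqG {m n : ℕ} (s t : ProfTerm m) : ProfFormula m n
  | eqI {m n : ℕ} (i j : Fin n) : ProfFormula m n
  | le {m n : ℕ} (i j : Fin n) : ProfFormula m n
  | K {m n : ℕ} (t : ProfTerm m) (i : Fin n) : ProfFormula m n
  | imp {m n : ℕ} (φ ψ : ProfFormula m n) : ProfFormula m n
  | allG {m n : ℕ} (φ : ProfFormula (m + 1) n) : ProfFormula m n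
  | allI {m n : ℕ} (φ : ProfFormula m (n + 1)) : ProfFormula m n

/-- The value of a term under an assignment of the variables. -/
def ProfTerm.eval (M : ProfStructure.{u, v}) {m : ℕ} (x : Fin m → M.Gp) : ProfTerm m → M.Gp
  | .var i => x i
  | .one => M.one
  | .mul s t => M.mul (s.eval M x) (t.eval M x)
  | .inv t => M.inv (t.eval M x)

/-- Satisfaction of a formula in a structure, under an assignment of the group variables and an
assignment of the index variables. -/
def ProfFormula.Realize (M : ProfStructure.{u, v}) :
    {m n : ℕ} → ProfFormula m n → (Fin m → M.Gp) → (Fin n → M.Ix) → Prop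
  | _, _, .falsum, _, _ => False
  | _, _, .eqG s t, x, _ => s.eval M x = t.eval M x
  | _, _, .eqI i j, _, w => w i = w j
  | _, _, .le i j, _, w => M.le (w i) (w j)
  | _, _, .K t i, x, w => M.K (t.eval M x) (w i)
  | _, _, .imp φ ψ, x, w => φ.Realize M x w → ψ.Realize M x w
  | _, _, .allG φ, x, w => ∀ g : M.Gp, φ.Realize M (Fin.snoc x g) w
  | _, _, .allI φ, x, w => ∀ i : M.Ix, φ.Realize M x (Fin.snoc w i)

/-- Sentences: formulas without free variables. -/
abbrev ProfSentence : Type := ProfFormula 0 0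

/-- A sentence is true in a structure. -/
def ProfStructure.Satisfies (M : ProfStructure.{u, v}) (σ : ProfSentence) : Prop :=
  σ.Realize M Fin.elim0 Fin.elim0

/-- The complete theory `Th(M)` of a structure. -/
def ProfStructure.theory (M : ProfStructure.{u, v}) : Set ProfSentence :=
  {σ | M.Satisfies σ}

/-- `M` is a model of `T`. -/
def ProfStructure.Models (M : ProfStructure.{u, v}) (T : Set ProfSentence) : Prop :=
  ∀ σ ∈ T, M.Satisfies σ

/-! ## The tree property of the second kind -/

/-- The formula `φ(x̄, ȳ)` has `TP₂` with respect to `T`. The tuple `x̄` consists of `p` group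
variables and `q` index variables, the tuple `ȳ` of `r` group variables and `s` index variables.
The array of parameters is `(a i j, b i j)`, and lies in a model `M` of `T`. Every row is
`k`-inconsistent: for any `k` distinct column indices, the conjunction of the corresponding
instances has no solution. Along every path the set of instances is consistent, that is, every
finite subset of it has a solution in `M`. -/
def HasTP2 (T : Set ProfSentence) {p q r s : ℕ} (φ : ProfFormula (p + r) (q + s)) : Prop :=
  ∃ (k : ℕ) (M : ProfStructure.{u, v}), M.Models T ∧
    ∃ (a : ℕ → ℕ → Fin r → M.Gp) (b : ℕ → ℕ → Fin s → M.Ix),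
      (∀ (i : ℕ) (J : Finset ℕ), J.card = k →
        ¬ ∃ (x : Fin p → M.Gp) (w : Fin q → M.Ix), ∀ j ∈ J,
          φ.Realize M (Fin.append x (a i j)) (Fin.append w (b i j))) ∧
      (∀ (f : ℕ → ℕ) (F : Finset ℕ),
        ∃ (x : Fin p → M.Gp) (w : Fin q → M.Ix), ∀ i ∈ F,
          φ.Realize M (Fin.append x (a i (f i))) (Fin.append w (b i (f i))))

/-- `T` is `NTP₂`: no formula has `TP₂` with respect to `T`. (The language is countable, so by
Löwenheim–Skolem this does not depend on the universes in which the models are taken.) -/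
def IsNTP2 (T : Set ProfSentence) : Prop :=
  ∀ (p q r s : ℕ) (φ : ProfFormula (p + r) (q + s)), ¬ HasTP2.{u, v} T φ

/-! ## Profinite groups as two-sorted structures -/

/-- A presentation of the topological group `G` with index set `I`: a family of open subgroups
`K i`, `i ∈ I`, that is a basis of neighbourhoods of `1`, with `i ≤ j` if and only if
`K i ≥ K j`. -/
structure ProfPresentation (G : Type u) (I : Type v) [Group G] [TopologicalSpace G]
    [PartialOrder I] where
  K : I → Subgroup G
  isOpen_K : ∀ i, IsOpen (K i : Set G)
  hasBasis : (𝓝 (1 : G)).HasBasis (fun _ : I => True) (fun i => (K i : Set G))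
  le_iff : ∀ i j, i ≤ j ↔ K j ≤ K i

/-- The two-sorted structure `(G, I)`. -/
def ProfPresentation.toStructure {G : Type u} {I : Type v} [Group G] [TopologicalSpace G]
    [PartialOrder I] (P : ProfPresentation G I) : ProfStructure.{u, v} where
  Gp := G
  Ix := I
  one := 1
  mul := fun x y => x * y
  inv := fun x => x⁻¹
  le := fun i j => i ≤ j
  K := fun x i => x ∈ P.K i

/-- The presentation is full: every open subgroup of `G` is one of the `K i`. -/
def ProfPresentation.IsFull {G : Type u} {I : Type v} [Group G] [TopologicalSpace G]
    [PartialOrder I] (P : ProfPresentation G I) : Prop :=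
  ∀ U : Subgroup G, IsOpen (U : Set G) → ∃ i, P.K i = U

/-! ## Rank of a profinite group -/

/-- The topological group `H` has a topological generating set with at most `r` elements: the
abstract subgroup generated by it is dense. -/
def TopGeneratedBy (H : Type u) [Group H] [TopologicalSpace H] (r : ℕ) : Prop :=
  ∃ S : Finset H, S.card ≤ r ∧ Dense (Subgroup.closure (S : Set H) : Set H)

/-- `G` has rank `r`: `r` is least such that every closed subgroup of `G` has a topological
generating set with at most `r` elements. -/
def HasRank (G : Type u) [Group G] [TopologicalSpace G] (r : ℕ) : Prop :=
  IsLeast {n : ℕ | ∀ H : Subgroup G, IsClosed (H : Set G) → TopGeneratedBy H n} r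

/-- `G` has finite rank. -/
def HasFiniteRank (G : Type u) [Group G] [TopologicalSpace G] : Prop :=
  ∃ r : ℕ, HasRank G r

/-!
The argument uses only the formula `x ∈ y K_w`, whose instances are the left cosets of the open
subgroups. If finite quotients of `G` contain grids of all sizes — rows of cosets of one subgroup
such that every choice of one coset from each row has a common element — then an infinite grid
exists in an ultrapower of the structure (`ProfFormula.realize_ultrapower` is Łoś's theorem), and
the formula has `TP₂` (`ProfPresentation.not_isNTP2_of_grids`). So under `NTP₂` there is an `n` such
that no finite quotient of `G` contains a grid of size `n`. Grids come from families of subgroups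
whose intersection has the largest possible index, the product of their indices. There are two
sources of such families.

* Subgroups of pairwise coprime indices. If infinitely many primes divide the orders of finite
  quotients of `G`, then large families of this kind exist
  (`HasCoprimeSubgroups.succ_of_surjective`): the Frattini argument and the Schur–Zassenhaus theorem
  add a new prime to a family already found. Hence only finitely many primes occur.
* Maximal subgroups of a finite `p`-group `P`, when the Frattini quotient of `P` is large. Hence all
  `p`-subgroups of finite quotients of `G` are generated by `n * n` elements
  (`IsPGroup.generated_of_not_hasGrid`).

A finite group is generated by generators of its Sylow subgroups, one for each prime, so there is a
common bound for the numbers of generators of all subgroups of finite quotients of `G`, and this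
bound passes to closed subgroups by compactness (`topGeneratedBy_of_quotients`).
-/

/-! ### Ultrapowers of two-sorted structures -/

/-- The ultrapower of a structure along an ultrafilter on `ℕ`; both sorts are germs of sequences. -/
def ProfStructure.ultrapower (M : ProfStructure.{u, v}) (U : Ultrafilter ℕ) :
    ProfStructure.{u, v} where
  Gp := (U : Filter ℕ).Germ M.Gp
  Ix := (U : Filter ℕ).Germ M.Ix
  one := ((fun _ => M.one : ℕ → M.Gp) : (U : Filter ℕ).Germ M.Gp)
  mul := Filter.Germ.map₂ M.mul
  inv := Filter.Germ.map M.inv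
  le := Filter.Germ.LiftRel M.le
  K := Filter.Germ.LiftRel M.K

/-- The element of the group sort of the ultrapower represented by a sequence. -/
def ProfStructure.ofSeqGp (M : ProfStructure.{u, v}) (U : Ultrafilter ℕ) (x : ℕ → M.Gp) :
    (M.ultrapower U).Gp :=
  (x : (U : Filter ℕ).Germ M.Gp)

/-- The element of the index sort of the ultrapower represented by a sequence. -/
def ProfStructure.ofSeqIx (M : ProfStructure.{u, v}) (U : Ultrafilter ℕ) (w : ℕ → M.Ix) :
    (M.ultrapower U).Ix :=
  (w : (U : Filter ℕ).Germ M.Ix)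

lemma ProfTerm.eval_ultrapower (M : ProfStructure.{u, v}) (U : Ultrafilter ℕ) {m : ℕ}
    (t : ProfTerm m) (x : Fin m → ℕ → M.Gp) :
    t.eval (M.ultrapower U) (fun i => M.ofSeqGp U (x i)) =
      M.ofSeqGp U (fun k => t.eval M (fun i => x i k)) := by
  induction t with
  | var i => rfl
  | one => rfl
  | mul s t hs ht => simp only [ProfTerm.eval, hs, ht]; rfl
  | inv t ht => simp only [ProfTerm.eval, ht]; rfl

lemma snoc_comp_apply {α β : Type*} {m : ℕ} (F : α → β) (x : Fin m → α) (a : α) :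
    (Fin.snoc (fun i => F (x i)) (F a) : Fin (m + 1) → β) =
      fun i => F ((Fin.snoc x a : Fin (m + 1) → α) i) := by
  funext i
  refine Fin.lastCases ?_ (fun j => ?_) i <;> simp

/-- Łoś's theorem for the two-sorted language. -/
lemma ProfFormula.realize_ultrapower (M : ProfStructure.{u, v}) (U : Ultrafilter ℕ) {m n : ℕ}
    (φ : ProfFormula m n) (x : Fin m → ℕ → M.Gp) (w : Fin n → ℕ → M.Ix) :
    φ.Realize (M.ultrapower U) (fun i => M.ofSeqGp U (x i)) (fun i => M.ofSeqIx U (w i)) ↔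
      ∀ᶠ k in (U : Filter ℕ), φ.Realize M (fun i => x i k) (fun i => w i k) := by
  induction φ with
  | falsum =>
    exact (Filter.eventually_false_iff_eq_bot.trans (iff_false_intro U.neBot.ne)).symm
  | eqG s t =>
    simp only [ProfFormula.Realize, ProfTerm.eval_ultrapower]
    exact Filter.Germ.coe_eq
  | eqI i j => exact Filter.Germ.coe_eq
  | le i j => exact Filter.Germ.liftRel_coe
  | K t i =>
    simp only [ProfFormula.Realize, ProfTerm.eval_ultrapower]
    exact Filter.Germ.liftRel_coe
  | imp φ ψ hφ hψ =>
    simp only [ProfFormula.Realize, hφ, hψ, Ultrafilter.eventually_imp]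
  | allG φ hφ =>
    simp only [ProfFormula.Realize]
    have key : ∀ g : ℕ → M.Gp,
        φ.Realize (M.ultrapower U) (Fin.snoc (fun i => M.ofSeqGp U (x i)) (M.ofSeqGp U g))
          (fun i => M.ofSeqIx U (w i)) ↔
        ∀ᶠ k in (U : Filter ℕ), φ.Realize M (Fin.snoc (fun i => x i k) (g k))
          (fun i => w i k) := by
      intro g
      have h := hφ (Fin.snoc x g) w
      rw [← snoc_comp_apply] at h
      rw [h]
      have e : ∀ k : ℕ, (fun i => (Fin.snoc x g : Fin (_ + 1) → ℕ → M.Gp) i k) =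
          Fin.snoc (fun i => x i k) (g k) :=
        fun k => (snoc_comp_apply (fun y : ℕ → M.Gp => y k) x g).symm
      simp only [e]
    constructor
    · intro h
      by_contra hc
      rw [← Ultrafilter.eventually_not] at hc
      -- a sequence of counterexamples, wherever there is one
      have : ∀ k, ∃ g : M.Gp, (∀ y, φ.Realize M (Fin.snoc (fun i => x i k) y)
          (fun i => w i k)) ∨
          ¬ φ.Realize M (Fin.snoc (fun i => x i k) g) (fun i => w i k) := by
        intro k
        by_cases hk : ∀ y, φ.Realize M (Fin.snoc (fun i => x i k) y) (fun i => w i k)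
        · exact ⟨M.one, Or.inl hk⟩
        · push Not at hk
          exact hk.imp fun y hy => Or.inr hy
      choose g hg using this
      obtain ⟨k, hk₁, hk₂⟩ := (hc.and ((key g).1 (h _))).exists
      exact (hg k).elim hk₁ (fun h' => h' hk₂)
    · intro h g
      induction g using Filter.Germ.inductionOn with
      | h g => exact (key g).2 (h.mono fun k hk => hk _)
  | allI φ hφ =>
    simp only [ProfFormula.Realize]
    have key : ∀ g : ℕ → M.Ix,
        φ.Realize (M.ultrapower U) (fun i => M.ofSeqGp U (x i))
          (Fin.snoc (fun i => M.ofSeqIx U (w i)) (M.ofSeqIx U g)) ↔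
        ∀ᶠ k in (U : Filter ℕ), φ.Realize M (fun i => x i k)
          (Fin.snoc (fun i => w i k) (g k)) := by
      intro g
      have h := hφ x (Fin.snoc w g)
      rw [← snoc_comp_apply] at h
      rw [h]
      have e : ∀ k : ℕ, (fun i => (Fin.snoc w g : Fin (_ + 1) → ℕ → M.Ix) i k) =
          Fin.snoc (fun i => w i k) (g k) :=
        fun k => (snoc_comp_apply (fun y : ℕ → M.Ix => y k) w g).symm
      simp only [e]
    constructor
    · intro h
      by_contra hc
      rw [← Ultrafilter.eventually_not] at hc
      obtain ⟨k₀, hk₀⟩ := hc.exists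
      push Not at hk₀
      have : ∀ k, ∃ g : M.Ix, (∀ y, φ.Realize M (fun i => x i k)
          (Fin.snoc (fun i => w i k) y)) ∨
          ¬ φ.Realize M (fun i => x i k) (Fin.snoc (fun i => w i k) g) := by
        intro k
        by_cases hk : ∀ y, φ.Realize M (fun i => x i k) (Fin.snoc (fun i => w i k) y)
        · exact ⟨hk₀.choose, Or.inl hk⟩
        · push Not at hk
          exact hk.imp fun y hy => Or.inr hy
      choose g hg using this
      obtain ⟨k, hk₁, hk₂⟩ := (hc.and ((key g).1 (h _))).exists
      exact (hg k).elim hk₁ (fun h' => h' hk₂)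
    · intro h g
      induction g using Filter.Germ.inductionOn with
      | h g => exact (key g).2 (h.mono fun k hk => hk _)

lemma ProfStructure.ultrapower_models (M : ProfStructure.{u, v}) (U : Ultrafilter ℕ) :
    (M.ultrapower U).Models M.theory := by
  intro σ hσ
  have h := (σ.realize_ultrapower M U Fin.elim0 Fin.elim0).2
    (Filter.Eventually.of_forall fun k => by
      convert (show σ.Realize M Fin.elim0 Fin.elim0 from hσ))
  unfold ProfStructure.Satisfies
  convert h

/-! ### Grids of cosets -/

/-- A grid of size `n` in a group: `n` rows, the `i`-th of which consists of `n` distinct left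
cosets `a i j * H i` of one subgroup `H i`, such that any choice of one coset from each row has a
common element. -/
def HasGrid (Q : Type*) [Group Q] (n : ℕ) : Prop :=
  ∃ (H : Fin n → Subgroup Q) (a : Fin n → Fin n → Q),
    (∀ i j j', j ≠ j' → (a i j)⁻¹ * a i j' ∉ H i) ∧
    ∀ f : Fin n → Fin n, ∃ x, ∀ i, (a i (f i))⁻¹ * x ∈ H i

lemma HasGrid.map_of_injective {Q R : Type*} [Group Q] [Group R] {n : ℕ} (f : Q →* R)
    (hf : Function.Injective f) (h : HasGrid Q n) : HasGrid R n := by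
  obtain ⟨H, a, h₁, h₂⟩ := h
  refine ⟨fun i => (H i).map f, fun i j => f (a i j), fun i j j' hj => ?_, fun g => ?_⟩
  · rw [← map_inv, ← map_mul, Subgroup.mem_map_iff_mem hf]
    exact h₁ i j j' hj
  · obtain ⟨x, hx⟩ := h₂ g
    refine ⟨f x, fun i => ?_⟩
    rw [← map_inv, ← map_mul, Subgroup.mem_map_iff_mem hf]
    exact hx i

/-- The formula `x ∈ y K_w` witnesses `TP₂` as soon as the group has grids of all finite sizes made
of cosets of open subgroups: the infinite array lives in an ultrapower. -/
lemma ProfPresentation.not_isNTP2_of_grids {G : Type u} {I : Type v} [Group G]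
    [TopologicalSpace G] [IsTopologicalGroup G] [PartialOrder I] (P : ProfPresentation G I)
    (hfull : P.IsFull)
    (h : ∀ n : ℕ, ∃ N : OpenNormalSubgroup G, HasGrid (G ⧸ N.toSubgroup) n) :
    ¬ IsNTP2.{u, v} P.toStructure.theory := by
  have h' : ∀ n : ℕ, ∃ (b : Fin n → I) (a : Fin n → Fin n → G),
      (∀ i j j', j ≠ j' → (a i j)⁻¹ * a i j' ∉ P.K (b i)) ∧
      ∀ f : Fin n → Fin n, ∃ x, ∀ i, (a i (f i))⁻¹ * x ∈ P.K (b i) := by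
    intro n
    obtain ⟨N, H, a, h₁, h₂⟩ := h n
    choose b hb using fun i => hfull ((H i).comap (QuotientGroup.mk' N.toSubgroup))
      (Subgroup.isOpen_mono (H₁ := N.toSubgroup)
        (fun x hx => by
          have : (QuotientGroup.mk' N.toSubgroup) x = 1 := (QuotientGroup.eq_one_iff x).2 hx
          rw [Subgroup.mem_comap, this]
          exact one_mem _) N.isOpen)
    choose a' ha' using fun i j => QuotientGroup.mk'_surjective N.toSubgroup (a i j)
    refine ⟨b, a', fun i j j' hj => ?_, fun f => ?_⟩
    · rw [hb, Subgroup.mem_comap, map_mul, map_inv, ha', ha']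
      exact h₁ i j j' hj
    · obtain ⟨x, hx⟩ := h₂ f
      obtain ⟨x, rfl⟩ := QuotientGroup.mk'_surjective N.toSubgroup x
      refine ⟨x, fun i => ?_⟩
      rw [hb, Subgroup.mem_comap, map_mul, map_inv, ha']
      exact hx i
  choose b a h₁ h₂ using h'
  obtain ⟨i₀, -⟩ := P.hasBasis.mem_iff.1 (Filter.univ_mem)
  let U : Ultrafilter ℕ := Filter.hyperfilter ℕ
  have hU : ∀ m : ℕ, ∀ᶠ k in (U : Filter ℕ), m < k := fun m =>
    (Filter.eventually_gt_atTop m).filter_mono Nat.hyperfilter_le_atTop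
  -- the finite grids, extended by default values to infinite arrays
  let a' : ℕ → ℕ → ℕ → G := fun i j k =>
    if hk : i < k ∧ j < k then a k ⟨i, hk.1⟩ ⟨j, hk.2⟩ else 1
  let b' : ℕ → ℕ → I := fun i k => if hk : i < k then b k ⟨i, hk⟩ else i₀
  let φ : ProfFormula (1 + 1) (0 + 1) :=
    .K (.mul (.inv (.var (Fin.natAdd 1 0))) (.var (Fin.castAdd 1 0))) (Fin.natAdd 0 0)
  let S := P.toStructure
  have hφ : ∀ (x : Fin 1 → ℕ → G) (w : Fin 0 → (S.ultrapower U).Ix) (i j : ℕ),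
      φ.Realize (S.ultrapower U)
        (Fin.append (fun t => S.ofSeqGp U (x t)) (fun _ : Fin 1 => S.ofSeqGp U (a' i j)))
        (Fin.append w (fun _ : Fin 1 => S.ofSeqIx U (b' i))) ↔
      ∀ᶠ k in (U : Filter ℕ), (a' i j k)⁻¹ * x 0 k ∈ P.K (b' i k) := by
    intro x w i j
    simp only [φ, ProfFormula.Realize, ProfTerm.eval, Fin.append_left, Fin.append_right]
    exact Filter.Germ.liftRel_coe
  intro hN
  refine hN 1 0 1 1 φ ⟨2, S.ultrapower U, S.ultrapower_models U,
    fun i j _ => S.ofSeqGp U (a' i j), fun i j _ => S.ofSeqIx U (b' i), ?_, ?_⟩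
  · rintro i J hJ ⟨x, w, hx⟩
    obtain ⟨j, j', hj, rfl⟩ := Finset.card_eq_two.1 hJ
    obtain ⟨y, hy⟩ : ∃ y : Fin 1 → ℕ → G, x = fun t => S.ofSeqGp U (y t) := by
      have : ∀ t, ∃ y : ℕ → G, x t = S.ofSeqGp U y := fun t => by
        induction x t using Filter.Germ.inductionOn with
        | h g => exact ⟨g, rfl⟩
      choose y hy using this
      exact ⟨y, funext hy⟩
    subst hy
    have e₁ := (hφ y w i j).1 (hx j (by simp))
    have e₂ := (hφ y w i j').1 (hx j' (by simp))
    obtain ⟨k, ⟨⟨⟨hk₁, hk₂⟩, hi⟩, hjk⟩, hjk'⟩ :=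
      ((((e₁.and e₂).and (hU i)).and (hU j)).and (hU j')).exists
    simp only [a', b', hi, hjk, hjk', and_self, dif_pos] at hk₁ hk₂
    refine h₁ k ⟨i, hi⟩ ⟨j, hjk⟩ ⟨j', hjk'⟩ (by simpa using hj) ?_
    have := mul_mem hk₁ (inv_mem hk₂)
    simpa [mul_assoc] using this
  · intro f F
    have hx : ∀ k : ℕ, ∃ x : G, ∀ (i : ℕ) (hi : i < k) (hf : f i < k),
        (a k ⟨i, hi⟩ ⟨f i, hf⟩)⁻¹ * x ∈ P.K (b k ⟨i, hi⟩) := by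
      intro k
      obtain ⟨x, hx⟩ := h₂ k fun i => if hf : f i < k then ⟨f i, hf⟩ else i
      refine ⟨x, fun i hi hf => ?_⟩
      have := hx ⟨i, hi⟩
      simpa only [hf, dif_pos] using this
    choose x hx using hx
    refine ⟨fun _ => S.ofSeqGp U x, Fin.elim0, fun i _ => ?_⟩
    refine (hφ (fun _ => x) _ i (f i)).2 ?_
    filter_upwards [hU i, hU (f i)] with k hi hf
    simp only [a', b', hi, hf, and_self, dif_pos]
    exact hx k i hi hf

/-! ### Independent families of subgroups -/

/-- A family of subgroups is independent if every choice of left cosets, one of each member, has a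
common element. -/
def CosetIndependent {Q ι : Type*} [Group Q] (H : ι → Subgroup Q) : Prop :=
  ∀ y : ι → Q, ∃ x, ∀ i, (y i)⁻¹ * x ∈ H i

lemma cosetIndependent_of_prod_index_le {Q ι : Type*} [Group Q] [Finite Q] [Fintype ι]
    (H : ι → Subgroup Q) (h : ∏ i, (H i).index ≤ (⨅ i, H i).index) : CosetIndependent H := by
  intro y
  have hb : Function.Bijective (Subgroup.quotientiInfEmbedding H) := by
    refine (Subgroup.quotientiInfEmbedding H).injective.bijective_of_nat_card_le ?_
    rw [Nat.card_pi]
    exact h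
  obtain ⟨x, hx⟩ := hb.2 fun i => (y i : Q ⧸ H i)
  obtain ⟨x, rfl⟩ := QuotientGroup.mk_surjective x
  refine ⟨x, fun i => ?_⟩
  have := congrFun hx i
  rw [Subgroup.quotientiInfEmbedding_apply_mk] at this
  exact QuotientGroup.eq.1 this.symm

lemma cosetIndependent_of_coprime_index {Q ι : Type*} [Group Q] [Finite Q] [Fintype ι]
    (H : ι → Subgroup Q) (h : Pairwise fun i j => (H i).index.Coprime (H j).index) :
    CosetIndependent H := by
  refine cosetIndependent_of_prod_index_le H (Nat.le_of_dvd
    (Nat.pos_of_ne_zero Subgroup.index_ne_zero_of_finite) ?_)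
  exact Fintype.prod_dvd_of_isRelPrime (fun i j hij => Nat.coprime_iff_isRelPrime.1 (h hij))
    fun i => Subgroup.index_dvd_of_le (iInf_le _ i)

lemma CosetIndependent.hasGrid {Q : Type*} [Group Q] [Finite Q] {n : ℕ} {H : Fin n → Subgroup Q}
    (h : CosetIndependent H) (hn : ∀ i, n ≤ (H i).index) : HasGrid Q n := by
  have : ∀ i, ∃ g : Fin n → Q ⧸ H i, Function.Injective g := fun i => by
    have e := Finite.equivFin (Q ⧸ H i)
    exact ⟨fun j => e.symm (Fin.castLE (hn i) j),
      e.symm.injective.comp (Fin.castLE_injective (hn i))⟩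
  choose g hg using this
  choose a ha using fun i j => QuotientGroup.mk_surjective (g i j)
  refine ⟨H, a, fun i j j' hj hmem => hj (hg i ?_), fun f => h _⟩
  rw [← ha i j, ← ha i j']
  exact QuotientGroup.eq.2 hmem

/-- In a rectangular independent family of proper subgroups, the row intersections carry a grid:
the cosets in a row differ from each other by the coordinate where they are nontrivial. -/
lemma CosetIndependent.hasGrid_of_prod {Q : Type*} [Group Q] {n : ℕ}
    {M : Fin n × Fin n → Subgroup Q} (h : CosetIndependent M) (hM : ∀ t, M t ≠ ⊤) :
    HasGrid Q n := by
  have : ∀ t, ∃ g : Q, g ∉ M t := fun t => by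
    simpa [Subgroup.eq_top_iff'] using hM t
  choose g hg using this
  choose a ha using fun i c =>
    h fun t => if t = (i, c) then g t else 1
  refine ⟨fun i => ⨅ j, M (i, j), a, fun i c c' hc hmem => ?_, fun f => ?_⟩
  · have e₁ := ha i c (i, c)
    have e₂ := ha i c' (i, c)
    have e₃ := Subgroup.mem_iInf.1 hmem c
    rw [if_pos rfl] at e₁
    rw [if_neg (by simpa using hc), inv_one, one_mul] at e₂
    have e₄ : a i c ∈ M (i, c) := by
      have := mul_mem e₂ (inv_mem e₃)
      simpa using this
    apply hg (i, c)
    have := mul_mem e₄ (inv_mem e₁)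
    simpa using this
  · obtain ⟨x, hx⟩ := h fun t => a t.1 (f t.1)
    exact ⟨x, fun i => Subgroup.mem_iInf.2 fun j => hx (i, j)⟩

/-! ### Generators of finite groups -/

lemma exists_finset_sup_closure_eq_top {P : Type*} [Group P] [Finite P] {p : ℕ}
    [Fact p.Prime] (hP : IsPGroup p P) (k : ℕ) :
    ∀ N : Subgroup P, N.index = p ^ k →
      ∃ S : Finset P, S.card ≤ k ∧ N ⊔ Subgroup.closure (S : Set P) = ⊤ := by
  classical
  have hp : 1 < p := (Fact.out : p.Prime).one_lt
  induction k using Nat.strong_induction_on with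
  | _ k ih =>
    intro N hN
    by_cases hT : N = ⊤
    · exact ⟨∅, by simp, by simp [hT]⟩
    obtain ⟨x, hx⟩ : ∃ x, x ∉ N := by simpa [Subgroup.eq_top_iff'] using hT
    set N' := N ⊔ Subgroup.closure {x} with hN'
    have hle : N ≤ N' := le_sup_left
    have hxN' : x ∈ N' := le_sup_right (a := N) (Subgroup.subset_closure rfl)
    obtain ⟨j, hj⟩ := hP.index N'
    have hdvd : N'.index < N.index := by
      refine lt_of_le_of_ne (Nat.le_of_dvd (Nat.pos_of_ne_zero Subgroup.index_ne_zero_of_finite)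
        (Subgroup.index_dvd_of_le hle)) fun he => hx ?_
      have : N = N' := by
        have h1 := Subgroup.relIndex_mul_index hle
        rw [he] at h1
        have : N.relIndex N' = 1 :=
          Nat.eq_of_mul_eq_mul_right
            (Nat.pos_of_ne_zero (Subgroup.index_ne_zero_of_finite (H := N))) (by rw [h1, one_mul])
        exact le_antisymm hle (Subgroup.relIndex_eq_one.1 this)
      rw [this]; exact hxN'
    rw [hj, hN] at hdvd
    have hjk : j < k := (Nat.pow_lt_pow_iff_right hp).1 hdvd
    obtain ⟨S, hS, hS'⟩ := ih j hjk N' hj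
    refine ⟨insert x S, (Finset.card_insert_le _ _).trans (by omega), ?_⟩
    rw [Finset.coe_insert, Set.insert_eq, Subgroup.closure_union, ← sup_assoc]
    exact hS'

lemma IsPGroup.index_of_isCoatom {P : Type*} [Group P] [Finite P] {p : ℕ} [Fact p.Prime]
    (hP : IsPGroup p P) {M : Subgroup P} (hM : IsCoatom M) : M.index = p := by
  have hp : 1 < p := (Fact.out : p.Prime).one_lt
  obtain ⟨m, hm⟩ := (hP.to_subgroup M).exists_card_eq
  obtain ⟨k, hk⟩ := hP.index M
  have hc := M.card_mul_index
  have hk0 : k ≠ 0 := by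
    rintro rfl
    exact hM.1 (Subgroup.index_eq_one.1 (by simpa using hk))
  obtain ⟨K, hK, hMK⟩ := Sylow.exists_subgroup_card_pow_succ (G := P) (p := p) (n := m)
    (by rw [← hc, hm, hk, ← pow_add]; exact pow_dvd_pow _ (by omega)) hm
  have hlt : M < K := lt_of_le_of_ne hMK fun h => by
    rw [← h, hm] at hK
    exact absurd (Nat.pow_right_injective hp hK) (by omega)
  have hKT : K = ⊤ := hM.2 K hlt
  rw [hKT, Subgroup.card_top, ← hc, hm, pow_succ] at hK
  exact Nat.eq_of_mul_eq_mul_left (pow_pos (by omega) m) hK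

/-- A finite `p`-group is generated by `k` elements unless it has `k` maximal subgroups whose
intersection has index `p ^ k`. -/
lemma IsPGroup.generated_or_exists_maximal {P : Type*} [Group P] [Finite P] {p : ℕ}
    [Fact p.Prime] (hP : IsPGroup p P) (k : ℕ) :
    (∃ S : Finset P, S.card ≤ k ∧ Subgroup.closure (S : Set P) = ⊤) ∨
      ∃ M : Fin k → Subgroup P, (∀ i, (M i).index = p) ∧ (⨅ i, M i).index = p ^ k := by
  induction k with
  | zero => exact Or.inr ⟨Fin.elim0, fun i => i.elim0, by simp⟩
  | succ k ih =>
    rcases ih with ⟨S, hS, hS'⟩ | ⟨M, hM, hM'⟩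
    · exact Or.inl ⟨S, by omega, hS'⟩
    by_cases h : ∀ L : Subgroup P, IsCoatom L → ⨅ i, M i ≤ L
    · -- the intersection lies in the Frattini subgroup, so generators modulo it suffice
      obtain ⟨S, hS, hS'⟩ := exists_finset_sup_closure_eq_top hP k _ hM'
      refine Or.inl ⟨S, by omega, ?_⟩
      by_contra hne
      obtain ⟨L, hL, hle⟩ := (eq_top_or_exists_le_coatom _).resolve_left hne
      exact hL.1 (top_le_iff.1 (hS' ▸ sup_le (h L hL) hle))
    · push Not at h
      obtain ⟨L, hL, hnle⟩ := h
      have hLi := hP.index_of_isCoatom hL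
      have : Group.IsNilpotent P := hP.isNilpotent
      have : L.Normal := Subgroup.NormalizerCondition.normal_of_coatom L
        Group.normalizerCondition_of_isNilpotent hL
      refine Or.inr ⟨Fin.cons L M, Fin.forall_fin_succ.2 ⟨hLi, hM⟩, ?_⟩
      have e : ⨅ i, (Fin.cons L M : Fin (k + 1) → Subgroup P) i = (⨅ i, M i) ⊓ L := by
        ext x
        simp [Subgroup.mem_iInf, Subgroup.mem_inf, Fin.forall_fin_succ, and_comm]
      have hsup : (⨅ i, M i) ⊔ L = ⊤ := hL.2 _ (right_lt_sup.2 hnle)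
      rw [e, ← Subgroup.relIndex_mul_index (inf_le_left (a := ⨅ i, M i) (b := L)),
        Subgroup.inf_relIndex_left, ← Subgroup.relIndex_sup_right, hsup,
        Subgroup.relIndex_top_right, hLi, hM', pow_succ, mul_comm]

lemma IsPGroup.generated_of_not_hasGrid {P : Type*} [Group P] [Finite P] {p : ℕ}
    [Fact p.Prime] (hP : IsPGroup p P) {n : ℕ} (hn : ¬ HasGrid P n) :
    ∃ S : Finset P, S.card ≤ n * n ∧ Subgroup.closure (S : Set P) = ⊤ := by
  refine (hP.generated_or_exists_maximal (n * n)).resolve_right ?_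
  rintro ⟨M, hM, hM'⟩
  have hind : CosetIndependent M := by
    refine cosetIndependent_of_prod_index_le M ?_
    simp [hM, hM']
  refine hn (CosetIndependent.hasGrid_of_prod (M := fun t => M (finProdFinEquiv t)) ?_ ?_)
  · intro y
    obtain ⟨x, hx⟩ := hind fun i => y (finProdFinEquiv.symm i)
    exact ⟨x, fun t => by simpa using hx (finProdFinEquiv t)⟩
  · intro t ht
    have := hM (finProdFinEquiv t)
    rw [ht, Subgroup.index_top] at this
    exact (Fact.out : p.Prime).one_lt.ne this

/-- A finite group is generated by generators of its Sylow subgroups, one for each prime. -/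
lemma exists_generators_of_sylow {R : Type*} [Group R] [Finite R] {k : ℕ} {π : Finset ℕ}
    (hπ : ∀ p, p.Prime → p ∣ Nat.card R → p ∈ π)
    (hk : ∀ p, p.Prime → ∀ P : Subgroup R, IsPGroup p P →
      ∃ S : Finset P, S.card ≤ k ∧ Subgroup.closure (S : Set P) = ⊤) :
    ∃ S : Finset R, S.card ≤ π.card * k ∧ Subgroup.closure (S : Set R) = ⊤ := by
  classical
  have h : ∀ p : ℕ, ∃ S : Finset R, S.card ≤ k ∧
      ∀ hp : p.Prime, ∃ P : Sylow p R, (P : Subgroup R) ≤ Subgroup.closure (S : Set R) := by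
    intro p
    by_cases hp : p.Prime
    · have : Fact p.Prime := ⟨hp⟩
      obtain ⟨S, hS, hS'⟩ := hk p hp (default : Sylow p R) (default : Sylow p R).isPGroup'
      refine ⟨S.image (Subgroup.subtype _), Finset.card_image_le.trans hS,
        fun _ => ⟨default, ?_⟩⟩
      rw [Finset.coe_image, ← MonoidHom.map_closure, hS', ← MonoidHom.range_eq_map,
        Subgroup.range_subtype]
    · exact ⟨∅, by simp, fun h => absurd h hp⟩
  choose S hS hS' using h
  refine ⟨π.biUnion S, Finset.card_biUnion_le_card_mul _ _ _ fun p _ => hS p, ?_⟩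
  rw [← Subgroup.index_eq_one]
  by_contra hne
  obtain ⟨p, hp, hdvd⟩ := Nat.exists_prime_and_dvd hne
  have : Fact p.Prime := ⟨hp⟩
  obtain ⟨P, hP⟩ := hS' p hp
  have hpπ : p ∈ π := hπ p hp (hdvd.trans (Subgroup.index_dvd_card _))
  refine P.not_dvd_index (hdvd.trans (Subgroup.index_dvd_of_le (hP.trans ?_)))
  exact Subgroup.closure_mono (Finset.coe_subset.2 (Finset.subset_biUnion_of_mem S hpπ))

/-! ### Subgroups of coprime indices -/

/-- `Q` has a subgroup `S` with `n` subgroups whose indices in `S` are at least `m` and pairwise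
coprime. The subgroups are given as subgroups `H i` of `Q`, to be intersected with `S`. -/
def HasCoprimeSubgroups (Q : Type*) [Group Q] (n m : ℕ) : Prop :=
  ∃ (S : Subgroup Q) (H : Fin n → Subgroup Q), (∀ i, m ≤ (H i).relIndex S) ∧
    Pairwise fun i j => ((H i).relIndex S).Coprime ((H j).relIndex S)

lemma HasCoprimeSubgroups.hasGrid {Q : Type*} [Group Q] [Finite Q] {n : ℕ}
    (h : HasCoprimeSubgroups Q n n) : HasGrid Q n := by
  obtain ⟨S, H, h₁, h₂⟩ := h
  exact ((cosetIndependent_of_coprime_index (fun i => (H i).subgroupOf S) h₂).hasGrid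
    h₁).map_of_injective S.subtype S.subtype_injective

/-- If a new prime `p` appears in the kernel of `f`, a Sylow `p`-subgroup of the kernel is normal in
its normalizer, which still maps onto the quotient (Frattini) and contains a complement of it
(Schur–Zassenhaus). This complement prolongs the family of subgroups of coprime indices. -/
lemma HasCoprimeSubgroups.succ_of_surjective {R Q : Type*} [Group R] [Group Q] [Finite R]
    [Finite Q] {f : R →* Q} (hf : Function.Surjective f) {n m p : ℕ} (hp : p.Prime)
    (hpQ : ¬ p ∣ Nat.card Q) (hpR : p ∣ Nat.card R) (hm : m ≤ p)
    (h : HasCoprimeSubgroups Q n m) : HasCoprimeSubgroups R (n + 1) m := by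
  have : Fact p.Prime := ⟨hp⟩
  obtain ⟨S, H, h₁, h₂⟩ := h
  obtain ⟨P⟩ : Nonempty (Sylow p f.ker) := inferInstance
  set P₀ : Subgroup R := (P : Subgroup f.ker).map f.ker.subtype with hP₀
  have hfrat : Subgroup.normalizer (P₀ : Set R) ⊔ f.ker = ⊤ := Sylow.normalizer_sup_eq_top P
  have hmap : (Subgroup.normalizer (P₀ : Set R)).map f = ⊤ := by
    have := congrArg (Subgroup.map f) hfrat
    rwa [Subgroup.map_sup, (Subgroup.map_eq_bot_iff _).2 le_rfl, sup_bot_eq,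
      Subgroup.map_top_of_surjective f hf] at this
  have hker : f.ker.index = Nat.card Q := by
    rw [Subgroup.index_ker, MonoidHom.range_eq_top.2 hf, Subgroup.card_top]
  set T : Subgroup R := S.comap f ⊓ Subgroup.normalizer (P₀ : Set R) with hT
  have hTmap : T.map f = S := by
    refine le_antisymm ((Subgroup.map_mono inf_le_left).trans (Subgroup.map_comap_le _ _)) ?_
    intro y hy
    obtain ⟨x, hx, rfl⟩ := (hmap ▸ Subgroup.mem_top y : y ∈ Subgroup.map f _)
    exact ⟨x, ⟨hy, hx⟩, rfl⟩
  have hPker : P₀ ≤ f.ker := Subgroup.map_subtype_le _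
  have hPT : P₀ ≤ T := by
    refine le_inf (fun x hx => ?_) Subgroup.le_normalizer
    rw [Subgroup.mem_comap, (MonoidHom.mem_ker).1 (hPker hx)]
    exact one_mem _
  have hPcard : Nat.card P₀ = Nat.card P :=
    Nat.card_congr ((P : Subgroup f.ker).equivMapOfInjective _
      f.ker.subtype_injective).toEquiv.symm
  obtain ⟨k, hk⟩ := P.isPGroup'.exists_card_eq
  have hpker : p ∣ Nat.card f.ker := by
    have := f.ker.card_mul_index
    rw [hker] at this
    exact ((hp.dvd_mul).1 (this ▸ hpR)).resolve_right hpQ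
  have hk0 : k ≠ 0 := by
    rintro rfl
    have := P.dvd_card_of_dvd_card hpker
    rw [hk, pow_zero] at this
    exact hp.one_lt.ne' (Nat.dvd_one.1 this)
  have hPindex : ¬ p ∣ P₀.index := by
    rw [← Subgroup.relIndex_mul_index hPker, hker, hp.dvd_mul, not_or]
    refine ⟨?_, hpQ⟩
    rw [hP₀, Subgroup.relIndex, Subgroup.subgroupOf,
      Subgroup.comap_map_eq_self_of_injective f.ker.subtype_injective]
    exact P.not_dvd_index
  have hPrel : ¬ p ∣ P₀.relIndex T := fun hd => hPindex
    (hd.trans (Dvd.intro _ (Subgroup.relIndex_mul_index hPT)))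
  have hnormal : (P₀.subgroupOf T).Normal :=
    Subgroup.normal_subgroupOf_of_le_normalizer inf_le_right
  have hcard : Nat.card (P₀.subgroupOf T) = p ^ k := by
    rw [Nat.card_congr (Subgroup.subgroupOfEquivOfLe hPT).toEquiv, hPcard, hk]
  obtain ⟨K, hK⟩ := Subgroup.exists_right_complement'_of_coprime (N := P₀.subgroupOf T) (by
    rw [hcard]
    exact Nat.Coprime.pow_left _ ((Nat.Prime.coprime_iff_not_dvd hp).2 hPrel))
  have hKindex : (K.map T.subtype).relIndex T = p ^ k := by
    rw [Subgroup.relIndex, Subgroup.subgroupOf,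
      Subgroup.comap_map_eq_self_of_injective T.subtype_injective, hK.index_eq_card, hcard]
  have hrel : ∀ i, ((H i).comap f).relIndex T = (H i).relIndex S := fun i => by
    rw [Subgroup.relIndex_comap, hTmap]
  have hcop : ∀ i, (p ^ k).Coprime ((H i).relIndex S) := fun i => by
    refine Nat.Coprime.pow_left _ ((Nat.Prime.coprime_iff_not_dvd hp).2 fun hd => hpQ ?_)
    exact (hd.trans (Subgroup.relIndex_dvd_card _ _)).trans (Subgroup.card_subgroup_dvd_card S)
  refine ⟨T, Fin.cons (K.map T.subtype) fun i => (H i).comap f, ?_, ?_⟩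
  · refine Fin.forall_fin_succ.2 ⟨?_, fun i => ?_⟩
    · simp only [Fin.cons_zero, hKindex]
      exact hm.trans (Nat.le_self_pow hk0 p)
    · simp only [Fin.cons_succ, hrel]
      exact h₁ i
  · intro i j
    refine Fin.cases ?_ (fun i => ?_) i <;> refine Fin.cases ?_ (fun j => ?_) j
    · exact fun h => absurd rfl h
    · intro _
      simp only [Fin.cons_zero, Fin.cons_succ, hKindex, hrel]
      exact hcop j
    · intro _
      simp only [Fin.cons_zero, Fin.cons_succ, hKindex, hrel]
      exact (hcop i).symm
    · intro hij
      simp only [Fin.cons_succ, hrel]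
      exact h₂ fun h => hij (by rw [h])

/-! ### Profinite groups -/

instance OpenNormalSubgroup.finite_quotient {G : Type*} [Group G] [TopologicalSpace G]
    [IsTopologicalGroup G] [CompactSpace G] (N : OpenNormalSubgroup G) :
    Finite (G ⧸ N.toSubgroup) :=
  Subgroup.quotient_finite_of_isOpen _ N.isOpen

lemma exists_hasCoprimeSubgroups {G : Type*} [Group G] [TopologicalSpace G]
    [IsTopologicalGroup G] [CompactSpace G]
    (h : ∀ b : ℕ, ∃ p, p.Prime ∧ b ≤ p ∧ ∃ N : OpenNormalSubgroup G,
      p ∣ Nat.card (G ⧸ N.toSubgroup)) (m n : ℕ) :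
    ∃ N : OpenNormalSubgroup G, HasCoprimeSubgroups (G ⧸ N.toSubgroup) n m := by
  induction n with
  | zero =>
    obtain ⟨-, -, -, N, -⟩ := h 0
    exact ⟨N, ⊤, Fin.elim0, fun i => i.elim0, fun i => i.elim0⟩
  | succ n ih =>
    obtain ⟨N, hN⟩ := ih
    obtain ⟨p, hp, hbp, N₁, hN₁⟩ := h (m + Nat.card (G ⧸ N.toSubgroup) + 1)
    have hle : (N ⊓ N₁).toSubgroup ≤ N.toSubgroup := fun x hx => hx.1
    have hle₁ : (N ⊓ N₁).toSubgroup ≤ N₁.toSubgroup := fun x hx => hx.2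
    refine ⟨N ⊓ N₁, hN.succ_of_surjective
      (f := QuotientGroup.map _ _ (MonoidHom.id G) hle) ?_ hp ?_ ?_ (by omega)⟩
    · exact QuotientGroup.map_surjective_of_surjective _ _ _
        (QuotientGroup.mk_surjective) _
    · exact fun hd => (Nat.le_of_dvd Nat.card_pos hd).not_gt
        ((Nat.lt_succ_of_le (Nat.le_add_left _ m)).trans_le hbp)
    · exact hN₁.trans (Subgroup.index_dvd_of_le hle₁)

/-- If the images of a closed subgroup in all finite quotients are generated by `r` elements, then
it is topologically generated by `r` elements: by compactness there is an `r`-tuple that generates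
all of these images. -/
lemma topGeneratedBy_of_quotients {G : Type u} [Group G] [TopologicalSpace G]
    [IsTopologicalGroup G] [CompactSpace G] [T2Space G] [TotallyDisconnectedSpace G] {r : ℕ}
    (H : Subgroup G) (hH : IsClosed (H : Set G))
    (h : ∀ N : OpenNormalSubgroup G, ∃ S : Finset (H.map (QuotientGroup.mk' N.toSubgroup)),
      S.card ≤ r ∧ Subgroup.closure (S : Set (H.map (QuotientGroup.mk' N.toSubgroup))) = ⊤) :
    TopGeneratedBy H r := by
  classical
  have : CompactSpace H := isCompact_iff_compactSpace.1 hH.isCompact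
  let q : ∀ N : OpenNormalSubgroup G, H →* G ⧸ N.toSubgroup := fun N =>
    (QuotientGroup.mk' N.toSubgroup).comp H.subtype
  let X : OpenNormalSubgroup G → Set (Fin r → H) := fun N =>
    {t | (Subgroup.closure (Set.range t)).map (q N) = (q N).range}
  have hX : (⋂ N, X N).Nonempty := by
    have hclosed : ∀ N, IsClosed (X N) := fun N => by
      have hd : DiscreteTopology (G ⧸ N.toSubgroup) :=
        QuotientGroup.discreteTopology N.isOpen
      have hq : Continuous fun t : Fin r → H => fun i => q N (t i) :=
        continuous_pi fun i => (continuous_quot_mk.comp continuous_subtype_val).comp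
          (continuous_apply i)
      have : X N = (fun t : Fin r → H => fun i => q N (t i)) ⁻¹'
          {s | Subgroup.closure (Set.range s) = (q N).range} := by
        ext t
        simp only [X, Set.mem_ofPred_eq, Set.mem_preimage, MonoidHom.map_closure, ← Set.range_comp]
        rfl
      rw [this]
      exact (isClosed_discrete _).preimage hq
    have : Nonempty (OpenNormalSubgroup G) := ⟨⟨⊤, Subgroup.normal_top⟩⟩
    refine IsCompact.nonempty_iInter_of_directed_nonempty_isCompact_isClosed X ?_ ?_
      (fun N => (hclosed N).isCompact) hclosed
    · have anti : ∀ {N N' : OpenNormalSubgroup G}, N.toSubgroup ≤ N'.toSubgroup →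
          X N ⊆ X N' := by
        intro N N' hle t ht
        have e : q N' = (QuotientGroup.map _ _ (MonoidHom.id G) hle).comp (q N) := by
          ext x; rfl
        simp only [X, Set.mem_ofPred_eq] at ht ⊢
        rw [e, ← Subgroup.map_map, ht, ← MonoidHom.range_comp]
      exact fun N N' => ⟨N ⊓ N', anti fun x hx => hx.1, anti fun x hx => hx.2⟩
    · intro N
      obtain ⟨S, hS, hS'⟩ := h N
      have hlift : ∀ y : H.map (QuotientGroup.mk' N.toSubgroup), ∃ x : H, q N x = y := by
        rintro ⟨y, x, hx, rfl⟩
        exact ⟨⟨x, hx⟩, rfl⟩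
      choose l hl using hlift
      -- an enumeration of `S`, padded by the identity
      obtain ⟨e, he⟩ : ∃ e : Fin r → H.map (QuotientGroup.mk' N.toSubgroup),
          (S : Set _) ⊆ Set.range e := by
        refine ⟨fun i => if hi : (i : ℕ) < S.card then S.equivFin.symm ⟨i, hi⟩ else 1,
          fun s hs => ⟨Fin.castLE hS (S.equivFin ⟨s, hs⟩), ?_⟩⟩
        simp
      refine ⟨fun i => l (e i), ?_⟩
      simp only [X, Set.mem_ofPred_eq]
      refine le_antisymm (Subgroup.map_le_range _ _) ?_
      have hrange : (q N).range =
          ((Subgroup.closure (S : Set (H.map (QuotientGroup.mk' N.toSubgroup)))).map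
            (Subgroup.subtype _)) := by
        rw [hS', ← MonoidHom.range_eq_map, Subgroup.range_subtype, MonoidHom.range_comp,
          Subgroup.range_subtype]
      rw [hrange, MonoidHom.map_closure, MonoidHom.map_closure]
      refine Subgroup.closure_mono ?_
      rintro _ ⟨s, hs, rfl⟩
      obtain ⟨i, rfl⟩ := he hs
      exact ⟨l (e i), ⟨i, rfl⟩, hl _⟩
  obtain ⟨t, ht⟩ := hX
  refine ⟨Finset.univ.image t, Finset.card_image_le.trans (by simp), ?_⟩
  rw [Finset.coe_image, Finset.coe_univ, Set.image_univ]
  intro x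
  rw [mem_closure_iff_nhds]
  intro V hV
  obtain ⟨W, hW, hWV⟩ := mem_nhds_subtype (H : Set G) x V |>.1 hV
  have hW' : (fun g => (x : G) * g) ⁻¹' W ∈ 𝓝 (1 : G) :=
    (continuous_const_mul (x : G)).continuousAt.preimage_mem_nhds (by simpa using hW)
  obtain ⟨O, hOW, hO, hO1⟩ := mem_nhds_iff.1 hW'
  obtain ⟨N, hN⟩ := ProfiniteGrp.exist_openNormalSubgroup_sub_open_nhds_of_one hO hO1
  have hx : q N x ∈ (Subgroup.closure (Set.range t)).map (q N) := by
    rw [(Set.mem_iInter.1 ht N : _ = _)]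
    exact ⟨x, rfl⟩
  obtain ⟨y, hy, hxy⟩ := hx
  refine ⟨y, hWV ?_, hy⟩
  have hmem : (x : G)⁻¹ * y ∈ N.toSubgroup := QuotientGroup.eq.1 hxy.symm
  have := hOW (hN hmem)
  simpa using this

theorem lemma4p4 {G : Type u} {I : Type v} [Group G] [TopologicalSpace G] [IsTopologicalGroup G]
    [CompactSpace G] [T2Space G] [TotallyDisconnectedSpace G] [PartialOrder I]
    (P : ProfPresentation G I) (hfull : P.IsFull)
    (hNTP2 : IsNTP2.{u, v} P.toStructure.theory) :
    HasFiniteRank G := by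
  obtain ⟨n, hn⟩ : ∃ n, ∀ N : OpenNormalSubgroup G, ¬ HasGrid (G ⧸ N.toSubgroup) n := by
    by_contra! h
    exact P.not_isNTP2_of_grids hfull h hNTP2
  obtain ⟨b, hb⟩ : ∃ b : ℕ, ∀ p, p.Prime → b ≤ p →
      ∀ N : OpenNormalSubgroup G, ¬ p ∣ Nat.card (G ⧸ N.toSubgroup) := by
    by_contra! h
    obtain ⟨N, hN⟩ := exists_hasCoprimeSubgroups h n n
    exact hn N hN.hasGrid
  have key : ∃ r, ∀ H : Subgroup G, IsClosed (H : Set G) → TopGeneratedBy H r := by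
    refine ⟨(Finset.range b).card * (n * n),
      fun H hH => topGeneratedBy_of_quotients H hH fun N => ?_⟩
    refine exists_generators_of_sylow (fun p hp hd => ?_) fun p hp Q hQ => ?_
    · by_contra hpb
      exact hb p hp (by simpa using hpb) N (hd.trans (Subgroup.card_subgroup_dvd_card _))
    · have : Fact p.Prime := ⟨hp⟩
      refine hQ.generated_of_not_hasGrid fun hg => hn N ?_
      exact (hg.map_of_injective Q.subtype Q.subtype_injective).map_of_injective
        (Subgroup.subtype _) (Subgroup.subtype_injective _)
  classical
  exact ⟨Nat.find key, Nat.find_spec key, fun _ hm => Nat.find_min' key hm⟩
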